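/- Let $1<q<\infty$. Let $H^q$ be the Hardy space of holomorphic functions $g$ on the open unit disc $\mathbb{D}$ with $$\|g\|_q:=\Big(\sup_{0<r<1}\frac1{2\pi}\int_0^{2\pi}|g(re^{i\theta})|^q\,d\theta\Big)^{1/q}<\infty .$$ Let $\{a_k\}_{k=1}^\infty$ be a sequence of distinct points of $\mathbb{D}\setminus\{0\}$, and let $n>m\ge 0$ be integers. Then the two suprema below, taken over all $g\in H^q$ with $\|g\|_q=1$, are finite, and $$\sup_{\|g\|_q=1}\left|\sum_{j=1}^m g(a_j)\,\frac{\prod_{k=1}^m(1-\overline{a_k}a_j)}{\prod_{k=1,\,k\ne j}^m(a_k-a_j)}\right|<\sup_{\|g\|_q=1}\left|\sum_{j=1}^n g(a_j)\,\frac{\prod_{k=1}^n(1-\overline{a_k}a_j)}{\prod_{k=1,\,k\ne j}^n(a_k-a_j)}\right| ,$$ where empty products are $1$ and empty sums are $0$. -/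

import Mathlib

noncomputable section

/-- The `q`-th integral means `(1/2π) ∫₀^{2π} |g(r e^{iθ})|^q dθ` of `g` over the circles
of radius `0 < r < 1` centred at the origin. -/
def hardyMeans (q : ℝ) (g : ℂ → ℂ) : Set ℝ :=
  {x | ∃ r : ℝ, 0 < r ∧ r < 1 ∧
    x = (2 * Real.pi)⁻¹ *
      ∫ θ in (0 : ℝ)..(2 * Real.pi), ‖g ((r : ℂ) * Complex.exp ((θ : ℂ) * Complex.I))‖ ^ q}

/-- `g` belongs to the Hardy space `H^q` of the open unit disc (`0 < q < ∞`): it is holomorphic on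
the disc and its integral means are bounded. Values of `g` outside the disc play no role. -/
def MemHardy (q : ℝ) (g : ℂ → ℂ) : Prop :=
  DifferentiableOn ℂ g (Metric.ball (0 : ℂ) 1) ∧ BddAbove (hardyMeans q g)

/-- The norm of `H^q`: the `q`-th root of the supremum of the integral means. It is used only for
functions satisfying `MemHardy q`, for which this supremum is a genuine one. -/
def hardyNorm (q : ℝ) (g : ℂ → ℂ) : ℝ :=
  (sSup (hardyMeans q g)) ^ (1 / q)

/-- The sum `∑ⱼ g(aⱼ) · ∏ₖ (1 - conj(aₖ) aⱼ) / ∏_{k ≠ j} (aₖ - aⱼ)`, where `j` and `k` run over the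
first `m` points `a 0, …, a (m - 1)` of the sequence. -/
def dualSum (a : ℕ → ℂ) (m : ℕ) (g : ℂ → ℂ) : ℂ :=
  ∑ j ∈ Finset.range m, g (a j) *
    ((∏ k ∈ Finset.range m, (1 - (starRingEnd ℂ) (a k) * a j)) /
      (∏ k ∈ (Finset.range m).erase j, (a k - a j)))

/-- The absolute values of the above sum, as `g` runs over the unit sphere of `H^q`. -/
def dualValues (q : ℝ) (a : ℕ → ℂ) (m : ℕ) : Set ℝ :=
  {x | ∃ g : ℂ → ℂ, MemHardy q g ∧ hardyNorm q g = 1 ∧ x = ‖dualSum a m g‖}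

end

/-!
Let `B m` be the Blaschke product of the first `m` points. By Cauchy's formula, `Λ m = dualSum a m`
sends a function `u` continuous up to the circle to the circle average of `G = -z u / B m`, and
`|G| = |u|` on the circle. With `1 / p + 1 / q = 1` and `N m` the norm of `Λ m`, the functional
`u ↦ Re (Λ m u) - ‖u‖ ^ q / q`, which is the average of `Re G - |G| ^ q / q`, has supremum
`N m ^ p / p`.

Since the new factor of `B (m + 1)` gives room for a pole at the new point, the function
`(1 - t) G + t`, with `t` a small multiple of the Poisson kernel of that point, is again of the form
`-z v / B (m + 1)`. It is `G` moved towards the maximiser `1` of `w ↦ Re w - |w| ^ q / q`, and `t`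
is bounded below by some `κ > 0`; hence `(1 - κ) N m ^ p + κ ≤ N (m + 1) ^ p`, a strict gain as
soon as `N m < 1`.

That `N m < 1` is duality: `N m` is at most the `L ^ p` norm of `1 + B m h` for every `h` continuous
up to the circle, and if `B m 0 ≠ 0` this perturbation of `1` can be taken to be
`exp (-ε conj (B m 0) B m)`, whose norm is less than `1` for small `ε > 0`.
-/

open Real Metric Complex
open Filter (Tendsto)
open scoped ComplexConjugate Topology

lemma one_sub_conj_mul_eq (a : ℂ) {z : ℂ} (hz : ‖z‖ = 1) : 1 - conj a * z = z * conj (z - a) := by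
  rw [map_sub, mul_sub, mul_conj', hz]
  push_cast
  ring

lemma one_sub_conj_mul_ne_zero {a z : ℂ} (ha : ‖a‖ < 1) (hz : ‖z‖ ≤ 1) : 1 - conj a * z ≠ 0 := by
  intro h
  have norm_mul_eq : ‖a‖ * ‖z‖ = 1 := by simpa using congrArg norm (sub_eq_zero.1 h).symm
  nlinarith [norm_nonneg a, norm_nonneg z]

section CircleAverage

lemma continuous_uncurry_circleMap {X : Type*} [TopologicalSpace X] {F : ℂ → ℂ → X}
    {c d : ℂ} {R S : ℝ}
    (hF : ContinuousOn (Function.uncurry F) (sphere c |R| ×ˢ sphere d |S|)) :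
    Continuous (Function.uncurry fun s t ↦ F (circleMap c R s) (circleMap d S t)) :=
  hF.comp_continuous (f := fun x : ℝ × ℝ ↦ (circleMap c R x.1, circleMap d S x.2)) (by fun_prop)
    fun x ↦ ⟨circleMap_mem_sphere' c R x.1, circleMap_mem_sphere' d S x.2⟩

variable {E : Type*} [NormedAddCommGroup E] [NormedSpace ℝ E]

lemma norm_circleAverage_le (f : ℂ → E) (c : ℂ) (R : ℝ) :
    ‖circleAverage f c R‖ ≤ circleAverage (fun z ↦ ‖f z‖) c R := by
  rw [circleAverage, circleAverage, norm_smul, smul_eq_mul, Real.norm_of_nonneg (by positivity)]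
  gcongr
  exact intervalIntegral.norm_integral_le_integral_norm two_pi_pos.le

lemma circleAverage_re {f : ℂ → ℂ} {c : ℂ} {R : ℝ} (hf : CircleIntegrable f c R) :
    circleAverage (fun z ↦ (f z).re) c R = (circleAverage f c R).re :=
  reCLM.circleAverage_comp_comm hf

lemma circleAverage_comp_ofReal_mul (f : ℂ → E) (r : ℝ) :
    circleAverage (fun z ↦ f (r * z)) 0 1 = circleAverage f 0 r := by
  simp only [circleAverage, circleMap, zero_add, ofReal_one, one_mul]

lemma circleAverage_comp_mul_of_norm_eq_one (f : ℂ → E) (R : ℝ) {w : ℂ} (hw : ‖w‖ = 1) :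
    circleAverage (fun z ↦ f (w * z)) 0 R = circleAverage f 0 R := by
  have hw' : exp (w.arg * I) = w := by simpa [hw] using norm_mul_exp_arg_mul_I w
  rw [circleAverage_eq_integral_add w.arg (f := f), circleAverage]
  congr! 4 with θ
  rw [circleMap_zero, circleMap_zero, ofReal_add, add_mul, Complex.exp_add, hw']
  ring

lemma circleIntegrable_circleAverage {F : ℂ → ℂ → E} {c d : ℂ} {R S : ℝ}
    (hF : ContinuousOn (Function.uncurry F) (sphere c |R| ×ˢ sphere d |S|)) :
    CircleIntegrable (fun w ↦ circleAverage (F w) d S) c R :=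
  ((intervalIntegral.continuous_parametric_intervalIntegral_of_continuous'
    (continuous_uncurry_circleMap hF) 0 (2 * π)).const_smul (2 * π)⁻¹).intervalIntegrable _ _

lemma circleAverage_comm {F : ℂ → ℂ → E} {c d : ℂ} {R S : ℝ}
    (hF : ContinuousOn (Function.uncurry F) (sphere c |R| ×ˢ sphere d |S|)) :
    circleAverage (fun w ↦ circleAverage (F w) d S) c R =
      circleAverage (fun z ↦ circleAverage (fun w ↦ F w z) c R) d S := by
  simp only [circleAverage, intervalIntegral.integral_smul]
  rw [MeasureTheory.intervalIntegral_intervalIntegral_swap]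
  exact ((continuous_uncurry_circleMap hF).continuousOn.integrableOn_compact
    (isCompact_uIcc.prod isCompact_uIcc)).mono_set
      (Set.prod_mono Set.uIoc_subset_uIcc Set.uIoc_subset_uIcc)

/-- Averaging `ω φ ^ q ≥ ω A ^ q (1 + q (φ / A - 1))`, Bernoulli's inequality at `φ / A`, where `A`
is the weighted average of `φ`, cancels the term linear in `q`. -/
lemma rpow_circleAverage_mul_le {q : ℝ} (hq : 1 ≤ q) {ω φ : ℂ → ℝ} {c : ℂ} {R : ℝ}
    (hω : ∀ z ∈ sphere c |R|, 0 ≤ ω z) (hφ : ∀ z ∈ sphere c |R|, 0 ≤ φ z)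
    (hω_avg : circleAverage ω c R = 1) (hω_int : CircleIntegrable ω c R)
    (hωφ_int : CircleIntegrable (fun z ↦ ω z * φ z) c R)
    (hωφq_int : CircleIntegrable (fun z ↦ ω z * φ z ^ q) c R) :
    circleAverage (fun z ↦ ω z * φ z) c R ^ q ≤ circleAverage (fun z ↦ ω z * φ z ^ q) c R := by
  set A := circleAverage (fun z ↦ ω z * φ z) c R with hA
  have hA0 : 0 ≤ A := circleAverage_nonneg_of_nonneg fun z hz ↦ mul_nonneg (hω z hz) (hφ z hz)
  rcases hA0.eq_or_lt with hA_zero | hA_pos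
  · rw [← hA_zero, Real.zero_rpow (by linarith)]
    exact circleAverage_nonneg_of_nonneg fun z hz ↦
      mul_nonneg (hω z hz) (Real.rpow_nonneg (hφ z hz) q)
  have bernoulli : ∀ z ∈ sphere c |R|,
      (A ^ q * (1 - q)) • ω z + (A ^ q * q / A) • (ω z * φ z) ≤ ω z * φ z ^ q := fun z hz ↦ by
    have h := one_add_mul_self_le_rpow_one_add
      (by linarith [div_nonneg (hφ z hz) hA0] : -1 ≤ φ z / A - 1) hq
    rw [add_sub_cancel, Real.div_rpow (hφ z hz) hA0, le_div_iff₀ (by positivity)] at h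
    calc (A ^ q * (1 - q)) • ω z + (A ^ q * q / A) • (ω z * φ z)
        = ω z * ((1 + q * (φ z / A - 1)) * A ^ q) := by simp only [smul_eq_mul]; ring
      _ ≤ ω z * φ z ^ q := mul_le_mul_of_nonneg_left h (hω z hz)
  calc A ^ q = (A ^ q * (1 - q)) • circleAverage ω c R + (A ^ q * q / A) • A := by
        rw [hω_avg, smul_eq_mul, smul_eq_mul, div_mul_cancel₀ _ hA_pos.ne']; ring
    _ = circleAverage (fun z ↦ (A ^ q * (1 - q)) • ω z + (A ^ q * q / A) • (ω z * φ z)) c R := by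
        rw [hA, ← circleAverage_smul, ← circleAverage_smul,
          ← circleAverage_add hω_int.const_smul hωφ_int.const_smul]
        rfl
    _ ≤ circleAverage (fun z ↦ ω z * φ z ^ q) c R :=
        circleAverage_mono (hω_int.const_smul.add hωφ_int.const_smul) hωφq_int bernoulli

end CircleAverage

section PoissonKernel

variable {w z : ℂ}

lemma continuousOn_poissonKernel (hw : ‖w‖ < 1) :
    ContinuousOn (poissonKernel 0 w) (sphere 0 1) := by
  unfold poissonKernel
  refine ContinuousOn.div (by fun_prop) (by fun_prop) fun z hz ↦ ?_
  have hzw : z ≠ w := fun h ↦ hw.ne (h ▸ mem_sphere_zero_iff_norm.1 hz)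
  simpa [sub_eq_zero] using hzw

lemma poissonKernel_le (hw : ‖w‖ < 1) (hz : ‖z‖ = 1) :
    poissonKernel 0 w z ≤ (1 + ‖w‖) / (1 - ‖w‖) := by
  simpa [poissonKernel_eq_re_herglotzRieszKernel, herglotzRieszKernel] using
    re_herglotzRieszKernel_le (c := 0) (R := 1) (z := z) (w := w) (by simpa) (by simpa)

lemma le_poissonKernel (hw : ‖w‖ < 1) (hz : ‖z‖ = 1) :
    (1 - ‖w‖) / (1 + ‖w‖) ≤ poissonKernel 0 w z := by
  simpa [poissonKernel_eq_re_herglotzRieszKernel, herglotzRieszKernel] using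
    le_re_herglotzRieszKernel (c := 0) (R := 1) (z := z) (w := w) (by simpa) (by simpa)

lemma poissonKernel_nonneg (hw : ‖w‖ < 1) (hz : ‖z‖ = 1) : 0 ≤ poissonKernel 0 w z :=
  (div_nonneg (by linarith) (by positivity)).trans (le_poissonKernel hw hz)

lemma exists_mul_poissonKernel_mem_Icc (hw : ‖w‖ < 1) :
    ∃ ε : ℝ, ∃ κ ∈ Set.Ioo (0 : ℝ) 1, ∀ z, ‖z‖ = 1 → ε * poissonKernel 0 w z ∈ Set.Icc κ 1 := by
  have hw0 := norm_nonneg w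
  set ρ := (1 - ‖w‖) / (1 + ‖w‖)
  have hρ : 0 < ρ := div_pos (by linarith) (by linarith)
  have hρ_le : ρ ≤ 1 := (div_le_one (by linarith)).2 (by linarith)
  refine ⟨ρ / 2, ρ / 2 * ρ, ⟨by positivity, by nlinarith⟩, fun z hz ↦
    ⟨mul_le_mul_of_nonneg_left (le_poissonKernel hw hz) (by linarith), ?_⟩⟩
  calc ρ / 2 * poissonKernel 0 w z ≤ ρ / 2 * ρ⁻¹ := by
        rw [inv_div]
        exact mul_le_mul_of_nonneg_left (poissonKernel_le hw hz) (by linarith)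
    _ ≤ 1 := by
        rw [div_mul_eq_mul_div, mul_inv_cancel₀ hρ.ne']
        norm_num

lemma circleAverage_poissonKernel (hw : ‖w‖ < 1) : circleAverage (poissonKernel 0 w) 0 1 = 1 := by
  have reproduce_one : circleAverage (ofRealCLM ∘ poissonKernel 0 w) 0 1 = 1 := by
    convert! (diffContOnCl_const (c := (1 : ℂ))).circleAverage_poissonKernel_smul (w := w)
      (c := 0) (R := 1) (by simpa) using 2
    ext z
    simp [Pi.smul_apply']
  rw [ofRealCLM.circleAverage_comp_comm
    ((continuousOn_poissonKernel hw).circleIntegrable zero_le_one), ofRealCLM_apply]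
    at reproduce_one
  exact_mod_cast reproduce_one

lemma ofReal_poissonKernel (hz : ‖z‖ = 1) :
    (poissonKernel 0 w z : ℂ) = z * (1 - ‖w‖ ^ 2) / ((1 - conj w * z) * (z - w)) := by
  have hz0 : z ≠ 0 := norm_ne_zero_iff.1 (hz ▸ one_ne_zero)
  rw [poissonKernel, sub_zero, sub_zero, hz, one_sub_conj_mul_eq w hz, ofReal_div,
    ofReal_pow ‖z - w‖, ← Complex.conj_mul', mul_assoc, mul_div_mul_left _ _ hz0]
  push_cast
  rw [one_pow]

end PoissonKernel

section DiscAlgebra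

variable {q : ℝ} {u : ℂ → ℂ}

lemma continuousOn_sphere_of_diffContOnCl (hu : DiffContOnCl ℂ u (ball 0 1)) :
    ContinuousOn u (sphere 0 1) :=
  hu.continuousOn_ball.mono sphere_subset_closedBall

lemma continuousOn_norm_rpow {s : Set ℂ} (hu : ContinuousOn u s) (hq : 0 ≤ q) :
    ContinuousOn (fun z ↦ ‖u z‖ ^ q) s :=
  hu.norm.rpow_const fun _ _ ↦ Or.inr hq

lemma diffContOnCl_of_differentiableOn_closedBall (hu : DifferentiableOn ℂ u (closedBall 0 1)) :
    DiffContOnCl ℂ u (ball 0 1) :=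
  DifferentiableOn.diffContOnCl (by rwa [closure_ball _ one_ne_zero])

lemma diffContOnCl_comp_mul (hu : DifferentiableOn ℂ u (ball 0 1)) {w : ℂ} (hw : ‖w‖ < 1) :
    DiffContOnCl ℂ (fun z ↦ u (w * z)) (ball 0 1) := by
  refine diffContOnCl_of_differentiableOn_closedBall (hu.comp (by fun_prop) fun z hz ↦ ?_)
  rw [mem_closedBall_zero_iff] at hz
  rw [mem_ball_zero_iff, norm_mul]
  exact (mul_le_of_le_one_right (norm_nonneg w) hz).trans_lt hw

lemma diffContOnCl_rotation (hu : DiffContOnCl ℂ u (ball 0 1)) {w : ℂ} (hw : ‖w‖ = 1) :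
    DiffContOnCl ℂ (fun z ↦ u (w * z)) (ball 0 1) :=
  hu.comp (differentiable_id.const_mul w).diffContOnCl fun z hz ↦ by simpa [hw] using hz

lemma norm_rpow_le_circleAverage_poissonKernel (hq : 1 ≤ q) (hu : DiffContOnCl ℂ u (ball 0 1))
    {w : ℂ} (hw : ‖w‖ < 1) :
    ‖u w‖ ^ q ≤ circleAverage (fun z ↦ poissonKernel 0 w z * ‖u z‖ ^ q) 0 1 := by
  have hP := continuousOn_poissonKernel hw
  have hP_nonneg : ∀ z ∈ sphere (0 : ℂ) |1|, 0 ≤ poissonKernel 0 w z := fun z hz ↦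
    poissonKernel_nonneg hw (by simpa using hz)
  have hu_sphere := continuousOn_sphere_of_diffContOnCl hu
  have norm_le : ‖u w‖ ≤ circleAverage (fun z ↦ poissonKernel 0 w z * ‖u z‖) 0 1 := by
    rw [← hu.circleAverage_poissonKernel_smul (w := w) (by simpa)]
    refine (norm_circleAverage_le _ _ _).trans_eq (circleAverage_congr_sphere fun z hz ↦ ?_)
    simp [abs_of_nonneg (hP_nonneg z hz)]
  calc ‖u w‖ ^ q ≤ circleAverage (fun z ↦ poissonKernel 0 w z * ‖u z‖) 0 1 ^ q :=
        Real.rpow_le_rpow (norm_nonneg _) norm_le (by linarith)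
    _ ≤ _ := rpow_circleAverage_mul_le hq hP_nonneg (fun _ _ ↦ norm_nonneg _)
        (circleAverage_poissonKernel hw) (hP.circleIntegrable zero_le_one)
        ((hP.mul hu_sphere.norm).circleIntegrable zero_le_one)
        ((hP.mul (continuousOn_norm_rpow hu_sphere (by linarith))).circleIntegrable zero_le_one)

/-- The `q`-th integral mean of `g` over the circle of radius `r`; the case `r = 1`, which
`hardyMeans` leaves out, gives the norm of the functions continuous up to the unit circle. -/
noncomputable def integralMean (q : ℝ) (g : ℂ → ℂ) (r : ℝ) : ℝ :=
  circleAverage (fun z ↦ ‖g z‖ ^ q) 0 r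

lemma integralMean_nonneg (q : ℝ) (g : ℂ → ℂ) (r : ℝ) : 0 ≤ integralMean q g r :=
  circleAverage_nonneg_of_nonneg fun _ _ ↦ by positivity

lemma integralMean_one (q r : ℝ) : integralMean q (fun _ ↦ 1) r = 1 := by
  simp only [integralMean, norm_one, Real.one_rpow, circleAverage_const]

lemma integralMean_const_mul (q : ℝ) (c : ℂ) (g : ℂ → ℂ) (r : ℝ) :
    integralMean q (fun z ↦ c * g z) r = ‖c‖ ^ q * integralMean q g r := by
  simp only [integralMean, norm_mul, Real.mul_rpow (norm_nonneg _) (norm_nonneg _),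
    ← smul_eq_mul (‖c‖ ^ q), circleAverage_fun_smul]

lemma integralMean_dilation (q : ℝ) (g : ℂ → ℂ) (r : ℝ) :
    integralMean q (fun z ↦ g (r * z)) 1 = integralMean q g r :=
  circleAverage_comp_ofReal_mul (fun z ↦ ‖g z‖ ^ q) r

/-- Jensen's inequality bounds the value at `r` of each rotation of `u`; averaging over the
rotations turns these values into the mean over the circle of radius `r`. -/
lemma integralMean_le_integralMean_one (hq : 1 ≤ q) (hu : DiffContOnCl ℂ u (ball 0 1)) {r : ℝ}
    (hr0 : 0 ≤ r) (hr : r < 1) : integralMean q u r ≤ integralMean q u 1 := by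
  have hr_norm : ‖(r : ℂ)‖ < 1 := by rwa [norm_real, Real.norm_of_nonneg hr0]
  have hF : ContinuousOn (Function.uncurry fun w z ↦ poissonKernel 0 r z * ‖u (w * z)‖ ^ q)
      (sphere 0 |1| ×ˢ sphere 0 |1|) := by
    rw [abs_one]
    refine ((continuousOn_poissonKernel hr_norm).comp continuousOn_snd fun x hx ↦ hx.2).mul ?_
    refine (continuousOn_norm_rpow (continuousOn_sphere_of_diffContOnCl hu) (by linarith)).comp
      (f := fun x : ℂ × ℂ ↦ x.1 * x.2) (by fun_prop) fun x hx ↦ ?_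
    simp_all
  have rotated_le : ∀ w ∈ sphere (0 : ℂ) |1|, ‖u (r * w)‖ ^ q ≤
      circleAverage (fun z ↦ poissonKernel 0 r z * ‖u (w * z)‖ ^ q) 0 1 := fun w hw ↦ by
    rw [mul_comm]
    exact norm_rpow_le_circleAverage_poissonKernel hq
      (diffContOnCl_rotation hu (by simpa using hw)) hr_norm
  calc integralMean q u r = circleAverage (fun w ↦ ‖u (r * w)‖ ^ q) 0 1 :=
        (integralMean_dilation q u r).symm
    _ ≤ circleAverage (fun w ↦
          circleAverage (fun z ↦ poissonKernel 0 r z * ‖u (w * z)‖ ^ q) 0 1) 0 1 :=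
        circleAverage_mono ((continuousOn_norm_rpow (continuousOn_sphere_of_diffContOnCl
          (diffContOnCl_comp_mul hu.1 hr_norm)) (by linarith)).circleIntegrable zero_le_one)
          (circleIntegrable_circleAverage hF) rotated_le
    _ = circleAverage (fun z ↦
          circleAverage (fun w ↦ poissonKernel 0 r z * ‖u (w * z)‖ ^ q) 0 1) 0 1 :=
        circleAverage_comm hF
    _ = circleAverage (fun z ↦ integralMean q u 1 • poissonKernel 0 r z) 0 1 := by
        refine circleAverage_congr_sphere fun z hz ↦ ?_
        simp_rw [← smul_eq_mul (poissonKernel 0 r z), circleAverage_fun_smul, mul_comm _ z]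
        rw [circleAverage_comp_mul_of_norm_eq_one (fun z ↦ ‖u z‖ ^ q) 1 (by simpa using hz),
          smul_eq_mul, smul_eq_mul, mul_comm, integralMean]
    _ = integralMean q u 1 := by
        rw [circleAverage_fun_smul, circleAverage_poissonKernel hr_norm, smul_eq_mul, mul_one]

end DiscAlgebra

section Blaschke

variable {ι : Type*} {a : ι → ℂ} {s : Finset ι} {u : ℂ → ℂ} {z : ℂ}

/-- The finite Blaschke product with zeros `a k`, `k ∈ s`, normalized by the factors
`(a k - z) / (1 - conj (a k) * z)`. -/
noncomputable def blaschke (a : ι → ℂ) (s : Finset ι) (z : ℂ) : ℂ :=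
  ∏ k ∈ s, (a k - z) / (1 - conj (a k) * z)

lemma norm_blaschke (ha : ∀ k ∈ s, ‖a k‖ < 1) (hz : ‖z‖ = 1) : ‖blaschke a s z‖ = 1 := by
  rw [blaschke, norm_prod]
  refine Finset.prod_eq_one fun k hk ↦ ?_
  rw [norm_div, div_eq_one_iff_eq (norm_ne_zero_iff.2 (one_sub_conj_mul_ne_zero (ha k hk) hz.le)),
    one_sub_conj_mul_eq _ hz, norm_mul, hz, one_mul, RCLike.norm_conj, norm_sub_rev]

lemma blaschke_ne_zero (ha : ∀ k ∈ s, ‖a k‖ < 1) (hz : ‖z‖ = 1) : blaschke a s z ≠ 0 :=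
  norm_ne_zero_iff.1 (norm_blaschke ha hz ▸ one_ne_zero)

lemma blaschke_apply_zero (a : ι → ℂ) (s : Finset ι) : blaschke a s 0 = ∏ k ∈ s, a k := by
  simp [blaschke]

lemma diffContOnCl_blaschke (ha : ∀ k ∈ s, ‖a k‖ < 1) :
    DiffContOnCl ℂ (blaschke a s) (ball 0 1) := by
  refine diffContOnCl_of_differentiableOn_closedBall ?_
  unfold blaschke
  refine DifferentiableOn.fun_finsetProd fun k hk ↦ .div (by fun_prop) (by fun_prop) fun z hz ↦ ?_
  exact one_sub_conj_mul_ne_zero (ha k hk) (mem_closedBall_zero_iff.1 hz)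

/-- The function `-z u(z) / B(z)` on the unit circle, `B` being the Blaschke product. It has the
modulus of `u`, and its average over the circle is `dualSum`. -/
noncomputable def boundaryQuotient (a : ι → ℂ) (s : Finset ι) (u : ℂ → ℂ) (z : ℂ) : ℂ :=
  -(z * u z) / blaschke a s z

lemma norm_boundaryQuotient (ha : ∀ k ∈ s, ‖a k‖ < 1) (u : ℂ → ℂ) (hz : ‖z‖ = 1) :
    ‖boundaryQuotient a s u z‖ = ‖u z‖ := by
  rw [boundaryQuotient, norm_div, norm_blaschke ha hz, norm_neg, norm_mul, hz, one_mul, div_one]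

lemma continuousOn_boundaryQuotient (ha : ∀ k ∈ s, ‖a k‖ < 1)
    (hu : DiffContOnCl ℂ u (ball 0 1)) : ContinuousOn (boundaryQuotient a s u) (sphere 0 1) :=
  (continuousOn_id.mul (continuousOn_sphere_of_diffContOnCl hu)).neg.div
    (continuousOn_sphere_of_diffContOnCl (diffContOnCl_blaschke ha))
    fun _ hz ↦ blaschke_ne_zero ha (mem_sphere_zero_iff_norm.1 hz)

lemma circleAverage_id_mul_eq_zero (hu : DiffContOnCl ℂ u (ball 0 1)) :
    circleAverage (fun z ↦ z * u z) 0 1 = 0 := by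
  have h : DiffContOnCl ℂ (fun z ↦ z * u z) (ball 0 |1|) := by
    rw [abs_one]
    exact differentiable_id.diffContOnCl.smul hu
  rw [h.circleAverage, zero_mul]

end Blaschke

lemma inv_prod_sub_eq_sum {ι K : Type*} [DecidableEq ι] [Field K] {x : ι → K} {s : Finset ι}
    (hx : Set.InjOn x s) (hs : s.Nonempty) {z : K} (hz : ∀ k ∈ s, x k ≠ z) :
    (∏ k ∈ s, (x k - z))⁻¹ = ∑ j ∈ s, (x j - z)⁻¹ * (∏ k ∈ s.erase j, (x k - x j))⁻¹ := by
  have hz_neg : ∀ k ∈ s, -z ≠ -x k := fun k hk h ↦ hz k hk (neg_injective h).symm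
  have hx_neg : Set.InjOn (fun k ↦ -x k) s := neg_injective.comp_injOn hx
  have h := Lagrange.eval_interpolate_not_at_node (v := fun k ↦ -x k) 1 hz_neg
  rw [Lagrange.interpolate_one hx_neg hs, Polynomial.eval_one,
    Lagrange.eval_nodal] at h
  simp only [Lagrange.nodalWeight, neg_sub_neg, Pi.one_apply, mul_one, Finset.prod_inv_distrib]
    at h
  rw [inv_eq_of_mul_eq_one_right h.symm]
  exact Finset.sum_congr rfl fun j _ ↦ mul_comm _ _

section DualSum

variable {a : ℕ → ℂ} {m : ℕ} {g u : ℂ → ℂ}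

lemma dualSum_const_mul (a : ℕ → ℂ) (m : ℕ) (c : ℂ) (g : ℂ → ℂ) :
    dualSum a m (fun z ↦ c * g z) = c * dualSum a m g := by
  simp only [dualSum, Finset.mul_sum, mul_assoc]

lemma boundaryQuotient_eq_sum (ha : Set.InjOn a (Finset.range m))
    (ha_disc : ∀ k ∈ Finset.range m, ‖a k‖ < 1) (hm : m ≠ 0) {z : ℂ} (hz : ‖z‖ = 1) :
    boundaryQuotient a (Finset.range m) u z = ∑ j ∈ Finset.range m,
      (∏ k ∈ (Finset.range m).erase j, (a k - a j))⁻¹ •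
        (((z - 0) / (z - a j)) • ((∏ k ∈ Finset.range m, (1 - conj (a k) * z)) • u z)) := by
  have hz_ne : ∀ k ∈ Finset.range m, a k ≠ z := fun k hk h ↦ (ha_disc k hk).ne (h ▸ hz)
  rw [boundaryQuotient, blaschke, Finset.prod_div_distrib, div_div_eq_mul_div, div_eq_mul_inv,
    inv_prod_sub_eq_sum ha (Finset.nonempty_range_iff.2 hm) hz_ne, Finset.mul_sum]
  refine Finset.sum_congr rfl fun j _ ↦ ?_
  rw [← neg_sub z (a j), inv_neg]
  simp only [smul_eq_mul, sub_zero]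
  ring

lemma dualSum_eq_circleAverage (ha : Set.InjOn a (Finset.range m))
    (ha_disc : ∀ k ∈ Finset.range m, ‖a k‖ < 1) (hu : DiffContOnCl ℂ u (ball 0 1)) :
    dualSum a m u = circleAverage (boundaryQuotient a (Finset.range m) u) 0 1 := by
  rcases eq_or_ne m 0 with rfl | hm
  · have quotient_eq : boundaryQuotient a (Finset.range 0) u = fun z ↦ z * (-u) z := by
      ext z
      simp [boundaryQuotient, blaschke]
    rw [quotient_eq, circleAverage_id_mul_eq_zero hu.neg]
    exact Finset.sum_range_zero _
  set W : ℂ → ℂ := fun z ↦ ∏ k ∈ Finset.range m, (1 - conj (a k) * z)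
  have hWu : DiffContOnCl ℂ (fun z ↦ W z • u z) (ball 0 1) :=
    (Differentiable.diffContOnCl (f := W) (by fun_prop)).smul hu
  rw [circleAverage_congr_sphere fun z hz ↦
    boundaryQuotient_eq_sum ha ha_disc hm (by simpa using hz), circleAverage_fun_sum]
  · refine Finset.sum_congr rfl fun j hj ↦ ?_
    rw [← abs_one] at hWu
    rw [circleAverage_fun_smul,
      hWu.circleAverage_smul_div (by simpa using ha_disc j hj), smul_eq_mul, smul_eq_mul]
    ring
  · intro j hj
    have hdiv : ContinuousOn (fun z ↦ (z - 0) / (z - a j)) (sphere 0 1) :=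
      .div (by fun_prop) (by fun_prop) fun z hz h ↦
        (ha_disc j hj).ne (sub_eq_zero.1 h ▸ mem_sphere_zero_iff_norm.1 hz)
    exact CircleIntegrable.const_fun_smul
      ((hdiv.smul (continuousOn_sphere_of_diffContOnCl hWu)).circleIntegrable zero_le_one)

lemma norm_dualSum_rpow_le {q : ℝ} (hq : 1 ≤ q) (ha : Set.InjOn a (Finset.range m))
    (ha_disc : ∀ k ∈ Finset.range m, ‖a k‖ < 1) (hu : DiffContOnCl ℂ u (ball 0 1)) :
    ‖dualSum a m u‖ ^ q ≤ integralMean q u 1 := by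
  have hu_sphere := continuousOn_sphere_of_diffContOnCl hu
  have jensen := rpow_circleAverage_mul_le hq (c := 0) (R := 1) (ω := fun _ ↦ 1)
    (φ := fun z ↦ ‖u z‖) (fun _ _ ↦ zero_le_one) (fun _ _ ↦ norm_nonneg _)
    (circleAverage_const 1 0 1) (circleIntegrable_const _ _ _)
  simp only [one_mul] at jensen
  have norm_le : ‖dualSum a m u‖ ≤ circleAverage (fun z ↦ ‖u z‖) 0 1 := by
    rw [dualSum_eq_circleAverage ha ha_disc hu]
    refine (norm_circleAverage_le _ _ _).trans_eq (circleAverage_congr_sphere fun z hz ↦ ?_)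
    exact norm_boundaryQuotient ha_disc u (by simpa using hz)
  exact (Real.rpow_le_rpow (norm_nonneg _) norm_le (by linarith)).trans
    (jensen (hu_sphere.norm.circleIntegrable zero_le_one)
      ((continuousOn_norm_rpow hu_sphere (by linarith)).circleIntegrable zero_le_one))

lemma tendsto_dualSum_dilation (ha_disc : ∀ k ∈ Finset.range m, ‖a k‖ < 1)
    (hg : DifferentiableOn ℂ g (ball 0 1)) :
    Tendsto (fun r : ℝ ↦ dualSum a m fun z ↦ g (r * z)) (𝓝[<] 1) (𝓝 (dualSum a m g)) := by
  refine tendsto_finsetSum _ fun j hj ↦ Tendsto.mul_const _ ?_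
  have hg_at : ContinuousAt g (a j) :=
    hg.continuousOn.continuousAt (isOpen_ball.mem_nhds (by simpa using ha_disc j hj))
  have dilation_tendsto : Tendsto (fun r : ℝ ↦ (r : ℂ) * a j) (𝓝 1) (𝓝 (a j)) := by
    simpa using (show Continuous fun r : ℝ ↦ (r : ℂ) * a j by fun_prop).tendsto 1
  exact (hg_at.tendsto.comp dilation_tendsto).mono_left nhdsWithin_le_nhds

lemma norm_dualSum_le_of_dilation (ha_disc : ∀ k ∈ Finset.range m, ‖a k‖ < 1)
    (hg : DifferentiableOn ℂ g (ball 0 1)) {C : ℝ}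
    (h : ∀ r ∈ Set.Ioo (0 : ℝ) 1, ‖dualSum a m fun z ↦ g (r * z)‖ ≤ C) : ‖dualSum a m g‖ ≤ C :=
  le_of_tendsto (tendsto_dualSum_dilation ha_disc hg).norm
    (Filter.eventually_of_mem (Ioo_mem_nhdsLT zero_lt_one) h)

end DualSum

section Hardy

variable {q : ℝ} {g u : ℂ → ℂ}

lemma hardyMeans_eq_image (q : ℝ) (g : ℂ → ℂ) :
    hardyMeans q g = integralMean q g '' Set.Ioo 0 1 := by
  ext x
  simp [hardyMeans, integralMean, circleAverage, circleMap, and_assoc, eq_comm]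

lemma hardyMeans_nonempty (q : ℝ) (g : ℂ → ℂ) : (hardyMeans q g).Nonempty := by
  rw [hardyMeans_eq_image]
  exact (Set.nonempty_Ioo.2 zero_lt_one).image _

lemma sSup_hardyMeans_nonneg (q : ℝ) (g : ℂ → ℂ) : 0 ≤ sSup (hardyMeans q g) := by
  rw [hardyMeans_eq_image]
  exact Real.sSup_nonneg (Set.forall_mem_image.2 fun r _ ↦ integralMean_nonneg q g r)

lemma hardyNorm_nonneg (q : ℝ) (g : ℂ → ℂ) : 0 ≤ hardyNorm q g :=
  Real.rpow_nonneg (sSup_hardyMeans_nonneg q g) _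

lemma hardyNorm_rpow (hq : 0 < q) (g : ℂ → ℂ) : hardyNorm q g ^ q = sSup (hardyMeans q g) := by
  rw [hardyNorm, one_div, Real.rpow_inv_rpow (sSup_hardyMeans_nonneg q g) hq.ne']

lemma MemHardy.integralMean_le (hq : 0 < q) (hg : MemHardy q g) {r : ℝ} (hr : r ∈ Set.Ioo 0 1) :
    integralMean q g r ≤ hardyNorm q g ^ q := by
  rw [hardyNorm_rpow hq]
  exact le_csSup hg.2 (hardyMeans_eq_image q g ▸ Set.mem_image_of_mem _ hr)

lemma integralMean_one_mem_upperBounds (hq : 1 ≤ q) (hu : DiffContOnCl ℂ u (ball 0 1)) :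
    integralMean q u 1 ∈ upperBounds (hardyMeans q u) := by
  rw [hardyMeans_eq_image]
  exact Set.forall_mem_image.2 fun r hr ↦ integralMean_le_integralMean_one hq hu hr.1.le hr.2

lemma memHardy_of_diffContOnCl (hq : 1 ≤ q) (hu : DiffContOnCl ℂ u (ball 0 1)) : MemHardy q u :=
  ⟨hu.1, _, integralMean_one_mem_upperBounds hq hu⟩

lemma hardyNorm_rpow_le (hq : 1 ≤ q) (hu : DiffContOnCl ℂ u (ball 0 1)) :
    hardyNorm q u ^ q ≤ integralMean q u 1 := by
  rw [hardyNorm_rpow (by linarith)]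
  exact csSup_le (hardyMeans_nonempty q u) (integralMean_one_mem_upperBounds hq hu)

open Pointwise in
lemma hardyMeans_const_mul (q : ℝ) (c : ℂ) (g : ℂ → ℂ) :
    hardyMeans q (fun z ↦ c * g z) = ‖c‖ ^ q • hardyMeans q g := by
  simp only [hardyMeans_eq_image, ← Set.image_smul, Set.image_image, integralMean_const_mul,
    smul_eq_mul]

lemma MemHardy.const_mul (hg : MemHardy q g) (c : ℂ) : MemHardy q (fun z ↦ c * g z) := by
  refine ⟨hg.1.const_mul c, ?_⟩
  rw [hardyMeans_const_mul]
  exact hg.2.smul_of_nonneg (by positivity)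

lemma hardyNorm_const_mul (hq : 0 < q) (c : ℂ) (g : ℂ → ℂ) :
    hardyNorm q (fun z ↦ c * g z) = ‖c‖ * hardyNorm q g := by
  rw [hardyNorm, hardyNorm, hardyMeans_const_mul, Real.sSup_smul_of_nonneg (by positivity),
    smul_eq_mul, Real.mul_rpow (by positivity) (sSup_hardyMeans_nonneg q g), one_div,
    Real.rpow_rpow_inv (norm_nonneg c) hq.ne']

lemma hardyNorm_one (q : ℝ) : hardyNorm q (fun _ ↦ 1) = 1 := by
  have mean_eq : integralMean q (fun _ ↦ 1) = fun _ ↦ 1 := funext (integralMean_one q)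
  rw [hardyNorm, hardyMeans_eq_image, mean_eq, (Set.nonempty_Ioo.2 zero_lt_one).image_const,
    csSup_singleton, Real.one_rpow]

end Hardy

section DualValues

variable {q : ℝ} {a : ℕ → ℂ} {m : ℕ} {g : ℂ → ℂ}

lemma MemHardy.norm_dualSum_le_hardyNorm (hq : 1 ≤ q) (ha : Set.InjOn a (Finset.range m))
    (ha_disc : ∀ k ∈ Finset.range m, ‖a k‖ < 1) (hg : MemHardy q g) :
    ‖dualSum a m g‖ ≤ hardyNorm q g := by
  have hq0 : 0 < q := by linarith
  refine norm_dualSum_le_of_dilation ha_disc hg.1 fun r hr ↦ ?_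
  have hg_dilation : DiffContOnCl ℂ (fun z ↦ g (r * z)) (ball 0 1) :=
    diffContOnCl_comp_mul hg.1 (by rw [norm_real, Real.norm_of_nonneg hr.1.le]; exact hr.2)
  rw [← Real.rpow_le_rpow_iff (norm_nonneg _) (hardyNorm_nonneg q g) hq0]
  calc ‖dualSum a m fun z ↦ g (r * z)‖ ^ q ≤ integralMean q (fun z ↦ g (r * z)) 1 :=
        norm_dualSum_rpow_le hq ha ha_disc hg_dilation
    _ = integralMean q g r := integralMean_dilation q g r
    _ ≤ hardyNorm q g ^ q := hg.integralMean_le hq0 hr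

lemma one_mem_upperBounds_dualValues (hq : 1 ≤ q) (ha : Set.InjOn a (Finset.range m))
    (ha_disc : ∀ k ∈ Finset.range m, ‖a k‖ < 1) :
    1 ∈ upperBounds (dualValues q a m) := by
  rintro _ ⟨g, hg, hg_norm, rfl⟩
  exact hg_norm ▸ hg.norm_dualSum_le_hardyNorm hq ha ha_disc

lemma bddAbove_dualValues (hq : 1 ≤ q) (ha : Set.InjOn a (Finset.range m))
    (ha_disc : ∀ k ∈ Finset.range m, ‖a k‖ < 1) : BddAbove (dualValues q a m) :=
  ⟨1, one_mem_upperBounds_dualValues hq ha ha_disc⟩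

lemma dualValues_nonempty (hq : 1 ≤ q) (a : ℕ → ℂ) (m : ℕ) : (dualValues q a m).Nonempty :=
  ⟨_, fun _ ↦ 1, memHardy_of_diffContOnCl hq diffContOnCl_const, hardyNorm_one q, rfl⟩

lemma sSup_dualValues_nonneg (q : ℝ) (a : ℕ → ℂ) (m : ℕ) : 0 ≤ sSup (dualValues q a m) :=
  Real.sSup_nonneg fun _ ⟨_, _, _, h⟩ ↦ h ▸ norm_nonneg _

lemma sSup_dualValues_le_one (hq : 1 ≤ q) (ha : Set.InjOn a (Finset.range m))
    (ha_disc : ∀ k ∈ Finset.range m, ‖a k‖ < 1) : sSup (dualValues q a m) ≤ 1 :=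
  csSup_le (dualValues_nonempty hq a m) (one_mem_upperBounds_dualValues hq ha ha_disc)

lemma MemHardy.norm_dualSum_le (hq : 1 ≤ q) (ha : Set.InjOn a (Finset.range m))
    (ha_disc : ∀ k ∈ Finset.range m, ‖a k‖ < 1) (hg : MemHardy q g) :
    ‖dualSum a m g‖ ≤ sSup (dualValues q a m) * hardyNorm q g := by
  rcases (hardyNorm_nonneg q g).eq_or_lt with norm_zero | norm_pos
  · simpa [← norm_zero] using hg.norm_dualSum_le_hardyNorm hq ha ha_disc
  set c : ℂ := (hardyNorm q g : ℂ)⁻¹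
  have hc : ‖c‖ = (hardyNorm q g)⁻¹ := by rw [norm_inv, norm_real, Real.norm_of_nonneg norm_pos.le]
  have normalized_mem : ‖dualSum a m fun z ↦ c * g z‖ ∈ dualValues q a m :=
    ⟨_, hg.const_mul c, by
      rw [hardyNorm_const_mul (by linarith), hc, inv_mul_cancel₀ norm_pos.ne'], rfl⟩
  have h := le_csSup (bddAbove_dualValues hq ha ha_disc) normalized_mem
  rwa [dualSum_const_mul, norm_mul, hc, inv_mul_le_iff₀ norm_pos, mul_comm] at h

end DualValues

section LegendreFunctional

variable {p q : ℝ} {a : ℕ → ℂ} {m : ℕ} {u h : ℂ → ℂ}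

lemma re_mul_sub_norm_rpow_le (hpq : q.HolderConjugate p) (w v : ℂ) :
    (w * v).re - ‖w‖ ^ q / q ≤ ‖v‖ ^ p / p := by
  have re_le := re_le_norm (w * v)
  rw [norm_mul] at re_le
  linarith [Real.young_inequality_of_nonneg (norm_nonneg w) (norm_nonneg v) hpq]

/-- The functional `u ↦ Re Λ(u) - ‖u‖ ^ q / q`, where `Λ` is `dualSum a m`. Its supremum over the
functions holomorphic in the disc and continuous on its closure is the Legendre transform
`N ^ p / p` of `‖·‖ ^ q / q` at `Λ`, with `N` the norm of `Λ`. -/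
noncomputable def dualObjective (q : ℝ) (a : ℕ → ℂ) (m : ℕ) (u : ℂ → ℂ) : ℝ :=
  (dualSum a m u).re - integralMean q u 1 / q

lemma dualSum_eq_circleAverage_mul (ha : Set.InjOn a (Finset.range m))
    (ha_disc : ∀ k ∈ Finset.range m, ‖a k‖ < 1) (hu : DiffContOnCl ℂ u (ball 0 1))
    (hh : DiffContOnCl ℂ h (ball 0 1)) :
    dualSum a m u = circleAverage (fun z ↦ boundaryQuotient a (Finset.range m) u z *
      (1 + blaschke a (Finset.range m) z * h z)) 0 1 := by
  have huh : DiffContOnCl ℂ (fun z ↦ u z * h z) (ball 0 1) := hu.smul hh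
  have huh_int : CircleIntegrable (fun z ↦ z * (u z * h z)) 0 1 :=
    (continuousOn_id.mul (continuousOn_sphere_of_diffContOnCl huh)).circleIntegrable zero_le_one
  have hG_int : CircleIntegrable (boundaryQuotient a (Finset.range m) u) 0 1 :=
    (continuousOn_boundaryQuotient ha_disc hu).circleIntegrable zero_le_one
  have sub_eq := circleAverage_sub hG_int huh_int
  rw [circleAverage_id_mul_eq_zero huh, sub_zero] at sub_eq
  rw [dualSum_eq_circleAverage ha ha_disc hu, ← sub_eq]
  refine circleAverage_congr_sphere fun z hz ↦ ?_
  have hB := blaschke_ne_zero ha_disc (z := z) (by simpa using hz)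
  simp only [Pi.sub_apply, boundaryQuotient]
  field_simp
  ring

lemma circleIntegrable_re_mul_sub_norm_rpow {G v : ℂ → ℂ} (hq : 0 ≤ q)
    (hG : ContinuousOn G (sphere 0 1)) (hv : ContinuousOn v (sphere 0 1)) :
    CircleIntegrable (fun z ↦ (G z * v z).re - ‖G z‖ ^ q / q) 0 1 :=
  ((continuous_re.comp_continuousOn (hG.mul hv)).sub
    ((continuousOn_norm_rpow hG hq).div_const q)).circleIntegrable zero_le_one

lemma continuousOn_one_add_blaschke_mul (ha_disc : ∀ k ∈ Finset.range m, ‖a k‖ < 1)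
    (hh : DiffContOnCl ℂ h (ball 0 1)) :
    ContinuousOn (fun z ↦ 1 + blaschke a (Finset.range m) z * h z) (sphere 0 1) :=
  continuousOn_const.add ((continuousOn_sphere_of_diffContOnCl (diffContOnCl_blaschke ha_disc)).mul
    (continuousOn_sphere_of_diffContOnCl hh))

lemma dualObjective_eq_circleAverage_mul (hq : 0 ≤ q) (ha : Set.InjOn a (Finset.range m))
    (ha_disc : ∀ k ∈ Finset.range m, ‖a k‖ < 1) (hu : DiffContOnCl ℂ u (ball 0 1))
    (hh : DiffContOnCl ℂ h (ball 0 1)) :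
    dualObjective q a m u = circleAverage (fun z ↦
      (boundaryQuotient a (Finset.range m) u z *
        (1 + blaschke a (Finset.range m) z * h z)).re -
      ‖boundaryQuotient a (Finset.range m) u z‖ ^ q / q) 0 1 := by
  have hG := continuousOn_boundaryQuotient ha_disc hu
  have hGv : ContinuousOn (fun z ↦ boundaryQuotient a (Finset.range m) u z *
      (1 + blaschke a (Finset.range m) z * h z)) (sphere 0 1) :=
    hG.mul (continuousOn_one_add_blaschke_mul ha_disc hh)
  have re_int : CircleIntegrable (fun z ↦ (boundaryQuotient a (Finset.range m) u z *
      (1 + blaschke a (Finset.range m) z * h z)).re) 0 1 :=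
    (continuous_re.comp_continuousOn hGv).circleIntegrable zero_le_one
  have mean_eq : circleAverage (fun z ↦ ‖boundaryQuotient a (Finset.range m) u z‖ ^ q / q) 0 1 =
      integralMean q u 1 / q := by
    simp only [div_eq_inv_mul, ← smul_eq_mul q⁻¹, circleAverage_fun_smul, integralMean]
    congr 1
    refine circleAverage_congr_sphere fun z hz ↦ ?_
    rw [norm_boundaryQuotient ha_disc u (by simpa using hz)]
  rw [circleAverage_fun_sub re_int
      (((continuousOn_norm_rpow hG hq).div_const q).circleIntegrable zero_le_one),
    circleAverage_re (hGv.circleIntegrable zero_le_one), mean_eq, dualObjective,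
    dualSum_eq_circleAverage_mul ha ha_disc hu hh]

lemma dualObjective_eq_circleAverage (hq : 0 ≤ q) (ha : Set.InjOn a (Finset.range m))
    (ha_disc : ∀ k ∈ Finset.range m, ‖a k‖ < 1) (hu : DiffContOnCl ℂ u (ball 0 1)) :
    dualObjective q a m u = circleAverage (fun z ↦
      (boundaryQuotient a (Finset.range m) u z).re -
      ‖boundaryQuotient a (Finset.range m) u z‖ ^ q / q) 0 1 := by
  simpa only [mul_zero, add_zero, mul_one] using
    dualObjective_eq_circleAverage_mul hq ha ha_disc hu (diffContOnCl_const (c := 0))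

lemma dualObjective_le_integralMean (hpq : q.HolderConjugate p)
    (ha : Set.InjOn a (Finset.range m)) (ha_disc : ∀ k ∈ Finset.range m, ‖a k‖ < 1)
    (hu : DiffContOnCl ℂ u (ball 0 1)) (hh : DiffContOnCl ℂ h (ball 0 1)) :
    dualObjective q a m u ≤
      integralMean p (fun z ↦ 1 + blaschke a (Finset.range m) z * h z) 1 / p := by
  have hv := continuousOn_one_add_blaschke_mul ha_disc hh
  rw [dualObjective_eq_circleAverage_mul hpq.nonneg ha ha_disc hu hh, div_eq_inv_mul,
    ← smul_eq_mul p⁻¹, integralMean, ← circleAverage_fun_smul]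
  refine circleAverage_mono
    (circleIntegrable_re_mul_sub_norm_rpow hpq.nonneg (continuousOn_boundaryQuotient ha_disc hu) hv)
    ((continuousOn_norm_rpow hv hpq.symm.nonneg).circleIntegrable zero_le_one).const_smul
    fun z _ ↦ ?_
  rw [smul_eq_mul, ← div_eq_inv_mul]
  exact re_mul_sub_norm_rpow_le hpq _ _

lemma dualObjective_le_sSup_dualValues (hpq : q.HolderConjugate p)
    (ha : Set.InjOn a (Finset.range m)) (ha_disc : ∀ k ∈ Finset.range m, ‖a k‖ < 1)
    (hu : DiffContOnCl ℂ u (ball 0 1)) :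
    dualObjective q a m u ≤ sSup (dualValues q a m) ^ p / p := by
  have hq := hpq.lt.le
  have re_le := (re_le_norm _).trans
    ((memHardy_of_diffContOnCl hq hu).norm_dualSum_le hq ha ha_disc)
  have young := Real.young_inequality_of_nonneg (hardyNorm_nonneg q u)
    (sSup_dualValues_nonneg q a m) hpq
  have norm_le := div_le_div_of_nonneg_right (hardyNorm_rpow_le hq hu) hpq.nonneg
  rw [dualObjective]
  linarith

/-- Equality in Young's inequality: `u` is multiplied by a constant `c` with `c Λ(u) = |Λ(u)| ^ p`
and `|c| ^ q = |Λ(u)| ^ p`. -/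
lemma exists_norm_dualSum_rpow_le_dualObjective (hpq : q.HolderConjugate p) (a : ℕ → ℂ) (m : ℕ)
    (hu : DiffContOnCl ℂ u (ball 0 1)) (hu_norm : integralMean q u 1 ≤ 1) :
    ∃ v, DiffContOnCl ℂ v (ball 0 1) ∧ ‖dualSum a m u‖ ^ p / p ≤ dualObjective q a m v := by
  obtain ⟨ζ, hζ, hζ_mul⟩ := RCLike.exists_norm_eq_mul_self (dualSum a m u)
  set x := ‖dualSum a m u‖
  have hx : 0 ≤ x := norm_nonneg _
  set c : ℂ := (x ^ (p - 1) : ℝ) * ζ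
  have hc_norm : ‖c‖ ^ q = x ^ p := by
    rw [norm_mul, hζ, mul_one, norm_real, Real.norm_of_nonneg (by positivity), ← Real.rpow_mul hx,
      hpq.symm.sub_one_mul_conj]
  have hc_mul : c * dualSum a m u = (x ^ p : ℝ) := by
    rw [mul_assoc, ← hζ_mul, RCLike.ofReal_eq_complex_ofReal, ← ofReal_mul,
      ← Real.rpow_add_one' hx (by simpa using hpq.symm.pos.ne'), sub_add_cancel]
  refine ⟨fun z ↦ c * u z, hu.const_smul c, ?_⟩
  have mean_le : x ^ p * integralMean q u 1 / q ≤ x ^ p / q :=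
    div_le_div_of_nonneg_right (mul_le_of_le_one_right (by positivity) hu_norm) hpq.nonneg
  have split := congrArg (x ^ p * ·) hpq.inv_add_inv_eq_one
  simp only [mul_add, mul_one, ← div_eq_mul_inv] at split
  rw [dualObjective, dualSum_const_mul, hc_mul, ofReal_re, integralMean_const_mul, hc_norm]
  linarith

lemma isLUB_dualObjective (hpq : q.HolderConjugate p) (ha : Set.InjOn a (Finset.range m))
    (ha_disc : ∀ k ∈ Finset.range m, ‖a k‖ < 1) :
    IsLUB (dualObjective q a m '' {u | DiffContOnCl ℂ u (ball 0 1)})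
      (sSup (dualValues q a m) ^ p / p) := by
  have hp := hpq.symm.pos
  refine ⟨Set.forall_mem_image.2 fun u hu ↦ dualObjective_le_sSup_dualValues hpq ha ha_disc hu,
    fun b hb ↦ ?_⟩
  have norm_dualSum_le : ∀ u, DiffContOnCl ℂ u (ball 0 1) → integralMean q u 1 ≤ 1 →
      ‖dualSum a m u‖ ^ p ≤ b * p := fun u hu hu_norm ↦ by
    obtain ⟨v, hv, hle⟩ := exists_norm_dualSum_rpow_le_dualObjective hpq a m hu hu_norm
    exact (div_le_iff₀ hp).1 (hle.trans (hb (Set.mem_image_of_mem _ hv)))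
  have hbp : 0 ≤ b * p := (Real.rpow_nonneg (norm_nonneg _) p).trans
    (norm_dualSum_le (fun _ ↦ 1) diffContOnCl_const (integralMean_one q 1).le)
  have sSup_le : sSup (dualValues q a m) ≤ (b * p) ^ p⁻¹ := by
    refine csSup_le (dualValues_nonempty hpq.lt.le a m) ?_
    rintro _ ⟨g, hg, hg_norm, rfl⟩
    refine norm_dualSum_le_of_dilation ha_disc hg.1 fun r hr ↦ ?_
    rw [Real.le_rpow_inv_iff_of_pos (norm_nonneg _) hbp hp]
    refine norm_dualSum_le _ (diffContOnCl_comp_mul hg.1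
      (by rw [norm_real, Real.norm_of_nonneg hr.1.le]; exact hr.2)) ?_
    rw [integralMean_dilation]
    simpa [hg_norm] using hg.integralMean_le hpq.pos hr
  rwa [div_le_iff₀ hp, ← Real.le_rpow_inv_iff_of_pos (sSup_dualValues_nonneg q a m) hbp hp]

end LegendreFunctional

section DualExtremal

variable {ι : Type*} {p : ℝ} {a : ι → ℂ} {s : Finset ι}

lemma circleAverage_exp_neg_half_lt_one {f : ℂ → ℝ} {c : ℂ} {R b : ℝ} (hb : 0 < b) (hb1 : b ≤ 1)
    (hf : ContinuousOn f (sphere c |R|)) (hf_le : ∀ z ∈ sphere c |R|, |f z| ≤ b)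
    (hf_avg : b ^ 2 ≤ circleAverage f c R) :
    circleAverage (fun z ↦ Real.exp (-(f z / 2))) c R < 1 := by
  have hf_int : CircleIntegrable f c R := hf.circleIntegrable'
  have exp_le : ∀ z ∈ sphere c |R|,
      Real.exp (-(f z / 2)) ≤ (1 + b ^ 2 / 4) - (2⁻¹ : ℝ) • f z := fun z hz ↦ by
    have hfz := hf_le z hz
    have abs_le_one : |-(f z / 2)| ≤ 1 := by
      rw [abs_neg, abs_div, abs_two]
      linarith
    have taylor := (abs_le.1 (Real.abs_exp_sub_one_sub_id_le abs_le_one)).2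
    rw [smul_eq_mul]
    nlinarith [sq_le_sq' (abs_le.1 hfz).1 (abs_le.1 hfz).2]
  calc circleAverage (fun z ↦ Real.exp (-(f z / 2))) c R
      ≤ circleAverage (fun z ↦ (1 + b ^ 2 / 4) - (2⁻¹ : ℝ) • f z) c R :=
        circleAverage_mono
          (Real.continuous_exp.comp_continuousOn (hf.div_const 2).neg).circleIntegrable'
          ((circleIntegrable_const _ _ _).sub hf_int.const_fun_smul) exp_le
    _ = (1 + b ^ 2 / 4) - 2⁻¹ * circleAverage f c R := by
        rw [circleAverage_fun_sub (circleIntegrable_const _ _ _) hf_int.const_fun_smul,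
          circleAverage_const, circleAverage_fun_smul, smul_eq_mul]
    _ < 1 := by nlinarith

lemma exists_one_add_mul_eq_exp {B : ℂ → ℂ} (hB : DiffContOnCl ℂ B (ball 0 1)) (c : ℂ) :
    ∃ h, DiffContOnCl ℂ h (ball 0 1) ∧ ∀ z, 1 + B z * h z = Complex.exp (c * B z) := by
  have exp_slope : Differentiable ℂ (dslope Complex.exp 0) := differentiableOn_univ.1
    ((differentiableOn_dslope Filter.univ_mem).2 Complex.differentiable_exp.differentiableOn)
  refine ⟨fun z ↦ c * dslope Complex.exp 0 (c * B z),
    (exp_slope.comp_diffContOnCl (hB.const_smul c)).const_smul c, fun z ↦ ?_⟩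
  have h := sub_smul_dslope Complex.exp 0 (c * B z)
  rw [sub_zero, smul_eq_mul, Complex.exp_zero] at h
  rw [← mul_assoc, mul_comm (B z), h, add_sub_cancel]

/-- For `1 + B h = exp (-w / (2 p))`, where `w = conj (B 0) * B`, the `p`-th power of the modulus is
`exp (-(Re w) / 2)`, and the average of `Re w` is `‖B 0‖ ^ 2`. -/
lemma exists_integralMean_one_add_blaschke_mul_lt_one (hp : 0 < p) (ha : ∀ k ∈ s, ‖a k‖ < 1)
    (ha_ne : ∀ k ∈ s, a k ≠ 0) :
    ∃ h, DiffContOnCl ℂ h (ball 0 1) ∧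
      integralMean p (fun z ↦ 1 + blaschke a s z * h z) 1 < 1 := by
  have norm_pos : 0 < ‖blaschke a s 0‖ := by
    rw [norm_pos_iff, blaschke_apply_zero]
    exact Finset.prod_ne_zero_iff.2 ha_ne
  have norm_le_one : ‖blaschke a s 0‖ ≤ 1 := by
    rw [blaschke_apply_zero, norm_prod]
    exact Finset.prod_le_one (fun _ _ ↦ norm_nonneg _) fun k hk ↦ (ha k hk).le
  set B := blaschke a s
  have hB : DiffContOnCl ℂ B (ball 0 1) := diffContOnCl_blaschke ha
  set w : ℂ → ℂ := fun z ↦ conj (B 0) * B z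
  have hw : DiffContOnCl ℂ w (ball 0 1) := hB.const_smul (conj (B 0))
  have hw_sphere := continuousOn_sphere_of_diffContOnCl hw
  have abs_re_le : ∀ z ∈ sphere (0 : ℂ) |1|, |(w z).re| ≤ ‖B 0‖ := fun z hz ↦ by
    refine (abs_re_le_norm _).trans_eq ?_
    rw [norm_mul, RCLike.norm_conj, norm_blaschke (z := z) ha (by simpa using hz), mul_one]
  have average_re : circleAverage (fun z ↦ (w z).re) 0 1 = ‖B 0‖ ^ 2 := by
    rw [circleAverage_re (hw_sphere.circleIntegrable zero_le_one),
      DiffContOnCl.circleAverage (by rwa [abs_one])]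
    exact_mod_cast congrArg re (Complex.conj_mul' (B 0))
  obtain ⟨h, hh, exp_eq⟩ := exists_one_add_mul_eq_exp hB (-((2 * p)⁻¹ : ℝ) * conj (B 0))
  have norm_rpow_eq (z : ℂ) : ‖1 + B z * h z‖ ^ p = Real.exp (-((w z).re / 2)) := by
    rw [exp_eq, mul_assoc, Complex.norm_exp, ← Real.exp_mul, ← ofReal_neg, re_ofReal_mul]
    congr 1
    field_simp
    rfl
  refine ⟨h, hh, ?_⟩
  simp only [integralMean, norm_rpow_eq]
  refine circleAverage_exp_neg_half_lt_one norm_pos norm_le_one ?_ abs_re_le average_re.ge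
  rw [abs_one]
  exact continuous_re.comp_continuousOn hw_sphere

end DualExtremal

lemma sSup_dualValues_lt_one {q : ℝ} (hq : 1 < q) {a : ℕ → ℂ} {m : ℕ}
    (ha : Set.InjOn a (Finset.range m)) (ha_disc : ∀ k ∈ Finset.range m, ‖a k‖ < 1)
    (ha_ne : ∀ k ∈ Finset.range m, a k ≠ 0) : sSup (dualValues q a m) < 1 := by
  have hpq := Real.HolderConjugate.conjExponent hq
  set p := q.conjExponent
  have hp := hpq.symm.pos
  obtain ⟨h, hh, mean_lt⟩ := exists_integralMean_one_add_blaschke_mul_lt_one hp ha_disc ha_ne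
  have rpow_le := (isLUB_dualObjective hpq ha ha_disc).2
    (Set.forall_mem_image.2 fun u hu ↦ dualObjective_le_integralMean hpq ha ha_disc hu hh)
  rw [div_le_div_iff_of_pos_right hp] at rpow_le
  exact (Real.rpow_lt_one_iff' (sSup_dualValues_nonneg q a m) hp).1 (rpow_le.trans_lt mean_lt)

section Competitor

variable {ι : Type*} {p q κ t : ℝ} {a : ι → ℂ} {s : Finset ι} {i : ι} {u : ℂ → ℂ} {z : ℂ}

lemma concaveOn_re_sub_norm_rpow (hq : 1 ≤ q) :
    ConcaveOn ℝ Set.univ fun w : ℂ ↦ w.re - ‖w‖ ^ q / q := by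
  have norm_image : norm '' (Set.univ : Set ℂ) = Set.Ici 0 := by rw [Set.image_univ, range_norm]
  have norm_rpow : ConvexOn ℝ Set.univ fun w : ℂ ↦ ‖w‖ ^ q :=
    ConvexOn.comp (norm_image ▸ convexOn_rpow hq) convexOn_univ_norm
      (norm_image ▸ Real.monotoneOn_rpow_Ici_of_exponent_nonneg (by linarith))
  simp only [div_eq_inv_mul]
  exact (reLm.concaveOn convex_univ).sub (norm_rpow.smul (by positivity))

/-- The concave function `w ↦ Re w - ‖w‖ ^ q / q` attains its maximum `1 / p` at `w = 1`. -/
lemma re_sub_norm_rpow_segment_one (hpq : q.HolderConjugate p) (w : ℂ) (hκ : 0 ≤ κ) (hκt : κ ≤ t)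
    (ht : t ≤ 1) : (1 - κ) * (w.re - ‖w‖ ^ q / q) + κ / p ≤
      ((1 - t) * w + t : ℂ).re - ‖(1 - t) * w + t‖ ^ q / q := by
  have value_le : w.re - ‖w‖ ^ q / q ≤ 1 / p := by
    simpa using re_mul_sub_norm_rpow_le hpq w 1
  have value_one : (1 : ℝ) - 1 / q = 1 / p := by
    rw [one_div, one_div, ← hpq.inv_add_inv_eq_one, add_sub_cancel_left]
  have concave := (concaveOn_re_sub_norm_rpow hpq.lt.le).2 (Set.mem_univ w) (Set.mem_univ 1)
    (sub_nonneg.2 ht) (hκ.trans hκt) (sub_add_cancel 1 t)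
  simp only [real_smul, smul_eq_mul, norm_one, Real.one_rpow, one_re, value_one, mul_one,
    ofReal_sub, ofReal_one] at concave
  refine le_trans ?_ concave
  have h := mul_le_mul_of_nonneg_left value_le (sub_nonneg.2 hκt)
  rw [div_eq_mul_one_div κ]
  linarith

lemma blaschke_insert [DecidableEq ι] (hi : i ∉ s) (z : ℂ) :
    blaschke a (insert i s) z = (a i - z) / (1 - conj (a i) * z) * blaschke a s z :=
  Finset.prod_insert hi

/-- The function whose `boundaryQuotient` for the zeros `a k`, `k ∈ insert i s`, is
`(1 - ε P) G + ε P`, where `G` is that of `u` for the zeros `a k`, `k ∈ s`, and `P` is the Poisson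
kernel of `a i`. -/
noncomputable def competitor (a : ι → ℂ) (s : Finset ι) (i : ι) (ε : ℝ) (u : ℂ → ℂ) (z : ℂ) : ℂ :=
  (a i - z) / (1 - conj (a i) * z) * u z +
    ε * (1 - ‖a i‖ ^ 2) / (1 - conj (a i) * z) ^ 2 * (z * u z + blaschke a s z)

lemma diffContOnCl_competitor (ha : ∀ k ∈ s, ‖a k‖ < 1) (hi : ‖a i‖ < 1) (ε : ℝ)
    (hu : DiffContOnCl ℂ u (ball 0 1)) : DiffContOnCl ℂ (competitor a s i ε u) (ball 0 1) := by
  have hne : ∀ z ∈ closedBall (0 : ℂ) 1, 1 - conj (a i) * z ≠ 0 := fun z hz ↦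
    one_sub_conj_mul_ne_zero hi (mem_closedBall_zero_iff.1 hz)
  have factor : DiffContOnCl ℂ (fun z ↦ (a i - z) / (1 - conj (a i) * z)) (ball 0 1) :=
    diffContOnCl_of_differentiableOn_closedBall (.div (by fun_prop) (by fun_prop) hne)
  have weight : DiffContOnCl ℂ (fun z ↦ (ε * (1 - ‖a i‖ ^ 2) : ℂ) / (1 - conj (a i) * z) ^ 2)
      (ball 0 1) :=
    diffContOnCl_of_differentiableOn_closedBall
      (.div (by fun_prop) (by fun_prop) fun z hz ↦ pow_ne_zero 2 (hne z hz))
  exact (factor.smul hu).add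
    (weight.smul ((differentiable_id.diffContOnCl.smul hu).add (diffContOnCl_blaschke ha)))

lemma boundaryQuotient_competitor [DecidableEq ι] (ha : ∀ k ∈ s, ‖a k‖ < 1) (hi : ‖a i‖ < 1)
    (his : i ∉ s) (ε : ℝ) (u : ℂ → ℂ) (hz : ‖z‖ = 1) :
    boundaryQuotient a (insert i s) (competitor a s i ε u) z =
      (1 - (ε * poissonKernel 0 (a i) z : ℝ)) * boundaryQuotient a s u z +
        (ε * poissonKernel 0 (a i) z : ℝ) := by
  have hB := blaschke_ne_zero ha hz
  have hd := one_sub_conj_mul_ne_zero hi hz.le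
  have he : z - a i ≠ 0 := sub_ne_zero.2 fun h ↦ hi.ne (h ▸ hz)
  rw [ofReal_mul, ofReal_poissonKernel hz, boundaryQuotient, boundaryQuotient, competitor,
    blaschke_insert his, ← neg_sub z (a i)]
  generalize 1 - conj (a i) * z = d at *
  generalize z - a i = e at *
  field_simp
  ring

end Competitor

section StrictMonotonicity

variable {p q ε κ : ℝ} {a : ℕ → ℂ} {m n : ℕ} {u : ℂ → ℂ}

lemma injOn_and_norm_lt_one_of_le (hmn : m ≤ n) (ha : Set.InjOn a (Finset.range n))
    (ha_disc : ∀ k ∈ Finset.range n, ‖a k‖ < 1) :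
    Set.InjOn a (Finset.range m) ∧ ∀ k ∈ Finset.range m, ‖a k‖ < 1 :=
  have range_subset := Finset.range_subset_range.2 hmn
  ⟨ha.mono (by exact_mod_cast range_subset), fun k hk ↦ ha_disc k (range_subset hk)⟩

lemma le_dualObjective_competitor (hpq : q.HolderConjugate p)
    (ha : Set.InjOn a (Finset.range (m + 1))) (ha_disc : ∀ k ∈ Finset.range (m + 1), ‖a k‖ < 1)
    (hu : DiffContOnCl ℂ u (ball 0 1)) (hκ : 0 ≤ κ)
    (weight_mem : ∀ z, ‖z‖ = 1 → ε * poissonKernel 0 (a m) z ∈ Set.Icc κ 1) :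
    (1 - κ) * dualObjective q a m u + κ / p ≤
      dualObjective q a (m + 1) (competitor a (Finset.range m) m ε u) := by
  obtain ⟨ha_m, disc_m⟩ := injOn_and_norm_lt_one_of_le m.le_succ ha ha_disc
  have disc_last : ‖a m‖ < 1 := ha_disc m (Finset.self_mem_range_succ m)
  have hv := diffContOnCl_competitor disc_m disc_last ε hu
  have integrable {l : ℕ} {v : ℂ → ℂ} (hl : ∀ k ∈ Finset.range l, ‖a k‖ < 1)
      (hv : DiffContOnCl ℂ v (ball 0 1)) :
      CircleIntegrable (fun z ↦ (boundaryQuotient a (Finset.range l) v z).re -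
        ‖boundaryQuotient a (Finset.range l) v z‖ ^ q / q) 0 1 := by
    simpa only [mul_one] using circleIntegrable_re_mul_sub_norm_rpow hpq.nonneg
      (continuousOn_boundaryQuotient hl hv) (continuousOn_const (c := 1))
  rw [dualObjective_eq_circleAverage hpq.nonneg ha_m disc_m hu,
    dualObjective_eq_circleAverage hpq.nonneg ha ha_disc hv, ← smul_eq_mul (1 - κ),
    ← circleAverage_fun_smul, ← circleAverage_const (κ / p) 0 1,
    ← circleAverage_fun_add (integrable disc_m hu).const_fun_smul (circleIntegrable_const _ _ _)]
  refine circleAverage_mono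
    ((integrable disc_m hu).const_fun_smul.add (circleIntegrable_const _ _ _))
    (integrable ha_disc hv) fun z hz ↦ ?_
  have hz : ‖z‖ = 1 := by simpa using hz
  simp only [Finset.range_add_one, smul_eq_mul,
    boundaryQuotient_competitor disc_m disc_last Finset.notMem_range_self ε u hz]
  exact re_sub_norm_rpow_segment_one hpq _ hκ (weight_mem z hz).1 (weight_mem z hz).2

lemma exists_one_sub_mul_sSup_dualValues_rpow_add_le (hpq : q.HolderConjugate p)
    (ha : Set.InjOn a (Finset.range (m + 1))) (ha_disc : ∀ k ∈ Finset.range (m + 1), ‖a k‖ < 1) :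
    ∃ κ ∈ Set.Ioo (0 : ℝ) 1,
      (1 - κ) * sSup (dualValues q a m) ^ p + κ ≤ sSup (dualValues q a (m + 1)) ^ p := by
  have hp := hpq.symm.pos
  obtain ⟨ha_m, disc_m⟩ := injOn_and_norm_lt_one_of_le m.le_succ ha ha_disc
  have disc_last : ‖a m‖ < 1 := ha_disc m (Finset.self_mem_range_succ m)
  obtain ⟨ε, κ, ⟨hκ, hκ_lt⟩, weight_mem⟩ := exists_mul_poissonKernel_mem_Icc disc_last
  refine ⟨κ, ⟨hκ, hκ_lt⟩, ?_⟩
  set M := sSup (dualValues q a (m + 1)) ^ p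
  have objective_le : ∀ u, DiffContOnCl ℂ u (ball 0 1) →
      dualObjective q a m u ≤ (M / p - κ / p) / (1 - κ) := fun u hu ↦ by
    have hv := diffContOnCl_competitor disc_m disc_last ε hu
    rw [le_div_iff₀' (by linarith)]
    linarith [(le_dualObjective_competitor hpq ha ha_disc hu hκ.le weight_mem).trans
      (dualObjective_le_sSup_dualValues hpq ha ha_disc hv)]
  have h := (isLUB_dualObjective hpq ha_m disc_m).2
    (Set.forall_mem_image.2 objective_le)
  rw [le_div_iff₀' (by linarith), ← sub_div, ← mul_div_assoc, div_le_div_iff_of_pos_right hp] at h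
  linarith

lemma sSup_dualValues_le_succ (hq : 1 < q) (ha : Set.InjOn a (Finset.range (m + 1)))
    (ha_disc : ∀ k ∈ Finset.range (m + 1), ‖a k‖ < 1) :
    sSup (dualValues q a m) ≤ sSup (dualValues q a (m + 1)) := by
  have hpq := Real.HolderConjugate.conjExponent hq
  obtain ⟨ha_m, disc_m⟩ := injOn_and_norm_lt_one_of_le m.le_succ ha ha_disc
  obtain ⟨κ, hκ, rpow_gain⟩ := exists_one_sub_mul_sSup_dualValues_rpow_add_le hpq ha ha_disc
  have rpow_le_one := Real.rpow_le_one (sSup_dualValues_nonneg q a m)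
    (sSup_dualValues_le_one hq.le ha_m disc_m) hpq.symm.nonneg
  rw [← Real.rpow_le_rpow_iff (sSup_dualValues_nonneg q a m) (sSup_dualValues_nonneg q a (m + 1))
    hpq.symm.pos]
  nlinarith [hκ.1]

lemma sSup_dualValues_lt_succ (hq : 1 < q) (ha : Set.InjOn a (Finset.range (m + 1)))
    (ha_disc : ∀ k ∈ Finset.range (m + 1), ‖a k‖ < 1) (ha_ne : ∀ k ∈ Finset.range m, a k ≠ 0) :
    sSup (dualValues q a m) < sSup (dualValues q a (m + 1)) := by
  have hpq := Real.HolderConjugate.conjExponent hq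
  obtain ⟨ha_m, disc_m⟩ := injOn_and_norm_lt_one_of_le m.le_succ ha ha_disc
  obtain ⟨κ, hκ, rpow_gain⟩ := exists_one_sub_mul_sSup_dualValues_rpow_add_le hpq ha ha_disc
  have rpow_lt_one := Real.rpow_lt_one (sSup_dualValues_nonneg q a m)
    (sSup_dualValues_lt_one hq ha_m disc_m ha_ne) hpq.symm.pos
  rw [← Real.rpow_lt_rpow_iff (sSup_dualValues_nonneg q a m) (sSup_dualValues_nonneg q a (m + 1))
    hpq.symm.pos]
  nlinarith [hκ.1]

lemma sSup_dualValues_mono (hq : 1 < q) (hmn : m ≤ n) (ha : Set.InjOn a (Finset.range n))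
    (ha_disc : ∀ k ∈ Finset.range n, ‖a k‖ < 1) :
    sSup (dualValues q a m) ≤ sSup (dualValues q a n) := by
  induction n, hmn using Nat.le_induction with
  | base => rfl
  | succ n _ ih =>
    obtain ⟨ha_n, disc_n⟩ := injOn_and_norm_lt_one_of_le n.le_succ ha ha_disc
    exact (ih ha_n disc_n).trans (sSup_dualValues_le_succ hq ha ha_disc)

end StrictMonotonicity

theorem corollary3p6_general {q : ℝ} (hq : 1 < q) {a : ℕ → ℂ} {m n : ℕ} (hmn : m < n)
    (ha : Set.InjOn a (Finset.range n)) (ha_disc : ∀ k ∈ Finset.range n, ‖a k‖ < 1)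
    (ha_ne : ∀ k ∈ Finset.range m, a k ≠ 0) :
    BddAbove (dualValues q a m) ∧ BddAbove (dualValues q a n) ∧
      sSup (dualValues q a m) < sSup (dualValues q a n) := by
  obtain ⟨ha_m, disc_m⟩ := injOn_and_norm_lt_one_of_le hmn.le ha ha_disc
  obtain ⟨ha_succ, disc_succ⟩ := injOn_and_norm_lt_one_of_le hmn ha ha_disc
  exact ⟨bddAbove_dualValues hq.le ha_m disc_m, bddAbove_dualValues hq.le ha ha_disc,
    (sSup_dualValues_lt_succ hq ha_succ disc_succ ha_ne).trans_le
      (sSup_dualValues_mono hq hmn ha ha_disc)⟩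

theorem corollary3p6 (q : ℝ) (hq : 1 < q) (a : ℕ → ℂ) (ha : Function.Injective a)
    (ha_disc : ∀ k, ‖a k‖ < 1) (ha_ne : ∀ k, a k ≠ 0) (m n : ℕ) (hmn : m < n) :
    BddAbove (dualValues q a m) ∧ BddAbove (dualValues q a n) ∧
      sSup (dualValues q a m) < sSup (dualValues q a n) :=
  corollary3p6_general hq hmn ha.injOn (fun k _ ↦ ha_disc k) fun k _ ↦ ha_ne k
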